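/- A Borel probability measure $\nu$ on $\mathbb{R}$ is called self-similar if there are finitely many maps $f_i(x)=s_i x+t_i$ $(1\le i\le n)$ with $s_i\in(-1,1)\setminus\{0\}$ and $t_i\in\mathbb{R}$, and a probability vector $(p_1,\dots,p_n)$ with all $p_i>0$, such that $\nu=\sum_{i=1}^n p_i\, f_i\nu$, where $f_i\nu$ is the push-forward of $\nu$ by $f_i$. For an integer $b\ge 2$ let $T_b(x)=bx \bmod 1\in[0,1)$; a number $x\in\mathbb{R}$ is normal to base $b$ if $\frac1N\sum_{n=1}^N\delta_{T_b^n(x)}$ converges in the weak-$*$ sense, as $N\to\infty$, to the Lebesgue measure on $[0,1]$. **Theorem.** Let $\nu$ be a non-atomic self-similar probability measure on $\mathbb{R}$. If its Fourier transform $\mathcal{F}_q(\nu)=\int e^{2\pi i x q}\,d\nu(x)$, $q\in\mathbb{R}$, satisfies $$\lim_{|q|\to\infty}\mathcal{F}_q(\nu)=0,$$ then $\nu$-almost every $x$ is normal to every integer base $b\ge 2$. -/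

import Mathlib

open MeasureTheory Filter Topology

/-- A self-similar iterated function system on `ℝ` with `n` maps `f i x = s i * x + t i`, each an
invertible contracting similarity. (Finitely many such maps always leave a common compact interval
invariant, e.g. `[-R, R]` with `R` large, so this is not recorded as a separate requirement.) -/
structure SelfSimilarIFS (n : ℕ) where
  s : Fin n → ℝ
  t : Fin n → ℝ
  s_ne_zero : ∀ i, s i ≠ 0
  abs_s_lt_one : ∀ i, |s i| < 1

/-- The `i`-th map of the system. -/
def SelfSimilarIFS.f {n : ℕ} (Φ : SelfSimilarIFS n) (i : Fin n) (x : ℝ) : ℝ :=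
  Φ.s i * x + Φ.t i

/-- `ν` is a self-similar probability measure: `ν = ∑ i, p i • (f i)_* ν` for some self-similar IFS
and some strictly positive probability vector `p`. -/
def IsSelfSimilarMeasure (ν : Measure ℝ) : Prop :=
  IsProbabilityMeasure ν ∧
    ∃ (n : ℕ) (Φ : SelfSimilarIFS n) (p : Fin n → ℝ),
      (∀ i, 0 < p i) ∧ ∑ i, p i = 1 ∧
        ν = ∑ i, ENNReal.ofReal (p i) • ν.map (Φ.f i)

/-- The Fourier transform `𝓕_q(μ) = ∫ exp(2πixq) dμ(x)`. -/
noncomputable def fourierMode (μ : Measure ℝ) (q : ℝ) : ℂ :=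
  ∫ x, Complex.exp (2 * Real.pi * Complex.I * x * q) ∂μ

/-- `μ` is Rajchman: `𝓕_q(μ) → 0` as `|q| → ∞`. -/
def IsRajchman (μ : Measure ℝ) : Prop :=
  Tendsto (fourierMode μ) (comap (fun q : ℝ => |q|) atTop) (𝓝 0)

/-- The times-`b` map `T_b(x) = b x mod 1`, with values in `[0, 1)`. -/
noncomputable def timesMap (b : ℕ) (x : ℝ) : ℝ := Int.fract ((b : ℝ) * x)

/-- `x` is normal to base `b`: the measures `(1/N) ∑_{n=1}^N δ_{T_b^n x}` converge to Lebesgue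
measure on `[0,1]` in the weak-* sense, that is, when tested against every continuous function
on `[0,1]`. -/
def IsNormalToBase (b : ℕ) (x : ℝ) : Prop :=
  ∀ g : ℝ → ℝ, ContinuousOn g (Set.Icc 0 1) →
    Tendsto (fun N : ℕ => (1 / (N : ℝ)) * ∑ n ∈ Finset.Icc 1 N, g ((timesMap b)^[n] x)) atTop
      (𝓝 (∫ y in Set.Icc (0 : ℝ) 1, g y))

/-- `x` is normal to every integer base `b ≥ 2`. -/
def IsAbsolutelyNormal (x : ℝ) : Prop :=
  ∀ b : ℕ, 2 ≤ b → IsNormalToBase b x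

/-- `μ`-almost every point is absolutely normal. -/
def IsPointwiseAbsolutelyNormal (μ : Measure ℝ) : Prop :=
  ∀ᵐ x ∂μ, IsAbsolutelyNormal x

/-! By Weyl's criterion it suffices that, for each base `b` and each integer `q ≠ 0`, the averages
of `cos (2π q b ^ n x + α)` become small for almost every `x`. Along a sparse progression of
exponents, with step `D = b ^ L`, the terms behave almost independently. At every scale `ν` is a
convex combination of affine copies of itself with comparable ratios
(`exists_hasScaleDecomposition`). At a suitable scale the first cosine is nearly constant on each
copy, while the remaining sum, restricted to a copy, is a sum of the same kind against `ν`, with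
frequency back in the window `[c * M, M]`. Fourier decay makes the mean of a single term at most
`ε`, so induction gives an exponential moment of at most `exp (4 ε² K)` for `K` terms
(`integral_exp_sum_cos_le`). Chernoff's bound and Borel–Cantelli turn this into an almost sure bound
of order `ε`, and summing over residues modulo `L` restores all exponents
(`ae_eventually_sum_cos_le`). -/

/-! ### Self-similar decompositions at a prescribed scale, and bounded support. -/

namespace SelfSimilarIFS

variable {n : ℕ} (Φ : SelfSimilarIFS n)

theorem continuous_f (i : Fin n) : Continuous (Φ.f i) := by
  unfold SelfSimilarIFS.f
  fun_prop

theorem exists_ratio_bounds (hn : 0 < n) :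
    ∃ c r : ℝ, 0 < c ∧ 0 < r ∧ r < 1 ∧ ∀ i, c ≤ |Φ.s i| ∧ |Φ.s i| ≤ r := by
  have : Nonempty (Fin n) := ⟨⟨0, hn⟩⟩
  obtain ⟨i, hi⟩ := Finite.exists_max fun i => |Φ.s i|
  obtain ⟨j, hj⟩ := Finite.exists_min fun i => |Φ.s i|
  exact ⟨|Φ.s j|, |Φ.s i|, abs_pos.2 (Φ.s_ne_zero j), abs_pos.2 (Φ.s_ne_zero i),
    Φ.abs_s_lt_one i, fun k => ⟨hj k, hi k⟩⟩

end SelfSimilarIFS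

/-- `ν` is a finite convex combination of affine images of itself, all of them with contraction
ratio comparable to `ρ`. -/
def HasScaleDecomposition (ν : Measure ℝ) (c ρ : ℝ) : Prop :=
  ∃ (ι : Type) (_ : Fintype ι) (p s t : ι → ℝ),
    (∀ w, 0 ≤ p w) ∧ ∑ w, p w = 1 ∧ (∀ w, c * ρ ≤ |s w| ∧ |s w| ≤ ρ) ∧
      ∀ F : ℝ → ℝ, Continuous F → (∃ C, ∀ x, |F x| ≤ C) →
        ∫ x, F x ∂ν = ∑ w, p w * ∫ x, F (s w * x + t w) ∂ν

theorem hasScaleDecomposition_one (ν : Measure ℝ) {c : ℝ} (hc : c ≤ 1) : HasScaleDecomposition ν c 1 :=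
  ⟨Unit, inferInstance, fun _ => 1, fun _ => 1, fun _ => 0, by simp, by simp, by simpa using hc,
    fun F _ _ => by simp⟩

theorem Continuous.integrable_of_abs_le {ν : Measure ℝ} [IsFiniteMeasure ν] {F : ℝ → ℝ}
    (hF : Continuous F) {C : ℝ} (hC : ∀ x, |F x| ≤ C) : Integrable F ν :=
  Integrable.of_bound hF.aestronglyMeasurable C (Eventually.of_forall hC)

section SelfSimilar

variable {ν : Measure ℝ} [IsProbabilityMeasure ν] {n : ℕ} {Φ : SelfSimilarIFS n} {p : Fin n → ℝ}

theorem integral_eq_sum_of_selfSimilar (hp : ∀ i, 0 < p i)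
    (hν : ν = ∑ i, ENNReal.ofReal (p i) • ν.map (Φ.f i)) {F : ℝ → ℝ} (hF : Continuous F)
    (hb : ∃ C, ∀ x, |F x| ≤ C) :
    ∫ x, F x ∂ν = ∑ i, p i * ∫ x, F (Φ.s i * x + Φ.t i) ∂ν := by
  obtain ⟨C, hC⟩ := hb
  conv_lhs => rw [hν]
  rw [integral_finsetSum_measure]
  · refine Finset.sum_congr rfl fun i _ => ?_
    rw [integral_smul_measure, integral_map (Φ.continuous_f i).aemeasurable
      hF.aestronglyMeasurable, ENNReal.toReal_ofReal (hp i).le, smul_eq_mul]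
    rfl
  · intro i _
    exact (hF.integrable_of_abs_le hC).smul_measure ENNReal.ofReal_ne_top

/-- A stopping-time argument: keep subdividing a cylinder until its ratio is at most `ρ`. The last
map applied contracts by a factor of at least `c`, so the ratio cannot fall below `c * ρ`. -/
theorem exists_hasScaleDecomposition (hp : ∀ i, 0 < p i) (hp1 : ∑ i, p i = 1)
    (hν : ν = ∑ i, ENNReal.ofReal (p i) • ν.map (Φ.f i)) :
    ∃ c : ℝ, 0 < c ∧ ∀ ρ : ℝ, 0 < ρ → ρ ≤ 1 → HasScaleDecomposition ν c ρ := by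
  have hn : 0 < n := by
    rcases Nat.eq_zero_or_pos n with rfl | h
    · simp at hp1
    · exact h
  obtain ⟨c, r, hc, hr, hr1, hcr⟩ := Φ.exists_ratio_bounds hn
  have hc1 : c ≤ 1 := ((hcr ⟨0, hn⟩).1.trans (hcr ⟨0, hn⟩).2).trans hr1.le
  refine ⟨c, hc, ?_⟩
  -- `m` bounds the depth still needed: applying a map `i` replaces the target `ρ` by `ρ / |s i| ≥ ρ
  -- / r`.
  have key : ∀ m : ℕ, ∀ ρ : ℝ, 0 < ρ → ρ ≤ 1 → r ^ m ≤ ρ → HasScaleDecomposition ν c ρ := by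
    intro m
    induction m with
    | zero =>
      intro ρ _ h1 h2
      obtain rfl : ρ = 1 := le_antisymm h1 (by simpa using h2)
      exact hasScaleDecomposition_one ν hc1
    | succ m ih =>
      intro ρ h0 h1 h2
      have hstep : ∀ i : Fin n, ∃ (ι : Type) (_ : Fintype ι) (q s t : ι → ℝ),
          (∀ w, 0 ≤ q w) ∧ ∑ w, q w = 1 ∧
          (∀ w, c * ρ ≤ |Φ.s i * s w| ∧ |Φ.s i * s w| ≤ ρ) ∧
          ∀ F : ℝ → ℝ, Continuous F → (∃ C, ∀ x, |F x| ≤ C) →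
            ∫ x, F x ∂ν = ∑ w, q w * ∫ x, F (s w * x + t w) ∂ν := by
        intro i
        have hs : 0 < |Φ.s i| := abs_pos.2 (Φ.s_ne_zero i)
        rcases le_or_gt |Φ.s i| ρ with hle | hlt
        · obtain ⟨ι, hι, q, s, t, h⟩ := hasScaleDecomposition_one ν le_rfl
          refine ⟨ι, hι, q, s, t, h.1, h.2.1, fun w => ?_, h.2.2.2⟩
          have hw : |s w| = 1 := le_antisymm (h.2.2.1 w).2 (by simpa using (h.2.2.1 w).1)
          rw [abs_mul, hw, mul_one]
          exact ⟨(mul_le_of_le_one_right hc.le h1).trans (hcr i).1, hle⟩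
        · obtain ⟨ι, hι, q, s, t, h⟩ := ih (ρ / |Φ.s i|) (by positivity)
            ((div_le_one hs).2 hlt.le) (by
              rw [le_div_iff₀ hs]
              refine le_trans ?_ h2
              rw [pow_succ]
              exact mul_le_mul_of_nonneg_left (hcr i).2 (by positivity))
          refine ⟨ι, hι, q, s, t, h.1, h.2.1, fun w => ?_, h.2.2.2⟩
          obtain ⟨h3, h4⟩ := h.2.2.1 w
          rw [abs_mul]
          constructor
          · rw [← mul_div_assoc, div_le_iff₀ hs] at h3
            linarith
          · rw [le_div_iff₀ hs] at h4
            linarith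
      choose ι hι q s t hq0 hq1 hs hF using hstep
      refine ⟨(i : Fin n) × ι i, inferInstance, fun w => p w.1 * q w.1 w.2,
        fun w => Φ.s w.1 * s w.1 w.2, fun w => Φ.s w.1 * t w.1 w.2 + Φ.t w.1,
        fun w => mul_nonneg (hp _).le (hq0 _ _), ?_, fun w => hs _ _, ?_⟩
      · rw [Fintype.sum_sigma]
        simp only [← Finset.mul_sum, hq1, mul_one, hp1]
      · intro F hFc ⟨C, hC⟩
        rw [integral_eq_sum_of_selfSimilar hp hν hFc ⟨C, hC⟩, Fintype.sum_sigma]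
        refine Finset.sum_congr rfl fun i _ => ?_
        rw [hF i (fun x => F (Φ.s i * x + Φ.t i)) (by fun_prop) ⟨C, fun x => hC _⟩, Finset.mul_sum]
        refine Finset.sum_congr rfl fun w _ => ?_
        rw [mul_assoc]
        congr 3
        ext x
        ring_nf
  intro ρ h0 h1
  obtain ⟨m, hm⟩ := exists_pow_lt_of_lt_one h0 hr1
  exact key m ρ h0 h1 hm.le

/-- The value `R = max |t i| / (1 - r)` makes `[-R, R]` invariant, and pulling back by any map
expands the excess of `|x|` over `R` by at least `1 / r`. Hence the mass beyond `R + 1` is at most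
the mass beyond `R + (1 / r) ^ k` for every `k`, which tends to `0`. -/
theorem exists_ae_abs_le_of_selfSimilar (hp : ∀ i, 0 < p i) (hp1 : ∑ i, p i = 1)
    (hν : ν = ∑ i, ENNReal.ofReal (p i) • ν.map (Φ.f i)) :
    ∃ R : ℝ, ∀ᵐ x ∂ν, |x| ≤ R := by
  have hn : 0 < n := by
    rcases Nat.eq_zero_or_pos n with rfl | h
    · simp at hp1
    · exact h
  obtain ⟨_, r, _, hr, hr1, hcr⟩ := Φ.exists_ratio_bounds hn
  have : Nonempty (Fin n) := ⟨⟨0, hn⟩⟩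
  obtain ⟨i₀, hi₀⟩ := Finite.exists_max fun i => |Φ.t i|
  set R : ℝ := |Φ.t i₀| / (1 - r) with hR
  have hR0 : 0 ≤ R := div_nonneg (abs_nonneg _) (by linarith)
  have hRt : ∀ i, |Φ.t i| ≤ R * (1 - r) := fun i => by
    rw [hR, div_mul_cancel₀ _ (by linarith)]
    exact hi₀ i
  have hmeas : ∀ a : ℝ, MeasurableSet {x : ℝ | R + a < |x|} := fun a =>
    measurableSet_lt measurable_const measurable_id.abs
  have hstep : ∀ a : ℝ, 0 ≤ a → ν {x | R + a < |x|} ≤ ν {x | R + a / r < |x|} := by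
    intro a ha
    conv_lhs => rw [hν]
    rw [Measure.finsetSum_apply]
    calc ∑ i, (ENNReal.ofReal (p i) • ν.map (Φ.f i)) {x | R + a < |x|}
        ≤ ∑ i, ENNReal.ofReal (p i) * ν {x | R + a / r < |x|} := by
          refine Finset.sum_le_sum fun i _ => ?_
          rw [Measure.smul_apply, smul_eq_mul,
            Measure.map_apply (Φ.continuous_f i).measurable (hmeas a)]
          gcongr
          intro x hx
          simp only [Set.mem_preimage, Set.mem_ofPred_eq, SelfSimilarIFS.f] at hx ⊢
          have h1 : |Φ.s i * x + Φ.t i| ≤ r * |x| + R * (1 - r) := by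
            refine (abs_add_le _ _).trans ?_
            rw [abs_mul]
            have := mul_le_mul_of_nonneg_right (hcr i).2 (abs_nonneg x)
            linarith [hRt i]
          have h2 : a / r < |x| - R := by
            rw [div_lt_iff₀ hr]
            nlinarith
          linarith
      _ = ν {x | R + a / r < |x|} := by
          rw [← Finset.sum_mul, ← ENNReal.ofReal_sum_of_nonneg fun i _ => (hp i).le, hp1]
          simp
  have hiter : ∀ k : ℕ, ν {x | R + 1 < |x|} ≤ ν {x | R + (1 / r) ^ k < |x|} := by
    intro k
    induction k with
    | zero => simp
    | succ k ih =>
      refine ih.trans ((hstep _ (by positivity)).trans_eq ?_)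
      rw [pow_succ, mul_one_div]
  have hlim : Tendsto (fun k : ℕ => ν {x : ℝ | R + (1 / r) ^ k < |x|}) atTop (𝓝 0) := by
    have hone : 1 < 1 / r := (one_lt_div hr).2 hr1
    have hanti : Antitone fun k : ℕ => {x : ℝ | R + (1 / r) ^ k < |x|} := by
      intro k l hkl x hx
      simp only [Set.mem_ofPred_eq] at hx ⊢
      have := pow_le_pow_right₀ hone.le hkl
      linarith
    have := tendsto_measure_iInter_atTop (μ := ν)
      (fun k => (hmeas ((1 / r) ^ k)).nullMeasurableSet) hanti ⟨0, measure_ne_top _ _⟩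
    have hempty : ⋂ k : ℕ, {x : ℝ | R + (1 / r) ^ k < |x|} = ∅ := by
      rw [Set.eq_empty_iff_forall_notMem]
      intro x hx
      obtain ⟨k, hk⟩ := pow_unbounded_of_one_lt |x| hone
      have := Set.mem_iInter.1 hx k
      simp only [Set.mem_ofPred_eq] at this
      linarith
    rwa [hempty, measure_empty] at this
  refine ⟨R + 1, ?_⟩
  have h0 : ν {x | R + 1 < |x|} = 0 := le_antisymm (ge_of_tendsto' hlim hiter) bot_le
  rw [ae_iff]
  simpa using h0

end SelfSimilar

/-! ### Exponential moments of lacunary cosine sums. -/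

theorem Real.exp_le_one_add_add_sq {y : ℝ} (hy : |y| ≤ 1) : Real.exp y ≤ 1 + y + y ^ 2 := by
  have := (abs_le.1 (Real.abs_exp_sub_one_sub_id_le hy)).2
  linarith

/-- The translation `τ` and the phase `α` only rotate the Fourier transform at `σ`. -/
theorem integral_cos_affine_le {ν : Measure ℝ} [IsProbabilityMeasure ν] (σ τ α : ℝ) :
    ∫ x, Real.cos (2 * Real.pi * (σ * x + τ) + α) ∂ν ≤ ‖fourierMode ν σ‖ := by
  have h : ∫ x, Real.cos (2 * Real.pi * (σ * x + τ) + α) ∂ν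
      = (Complex.exp ((2 * Real.pi * τ + α : ℝ) * Complex.I) * fourierMode ν σ).re := by
    unfold fourierMode
    rw [← integral_const_mul, ← RCLike.re_eq_complex_re, ← integral_re]
    · congr 1
      ext x
      rw [RCLike.re_eq_complex_re, ← Complex.exp_add, ← Complex.exp_ofReal_mul_I_re]
      congr 2
      push_cast
      ring
    · refine Integrable.of_bound (by fun_prop) 1 (Eventually.of_forall fun x => ?_)
      rw [norm_mul, Complex.norm_exp_ofReal_mul_I, one_mul]
      have : (2 * Real.pi * Complex.I * x * σ : ℂ) = (2 * Real.pi * x * σ : ℝ) * Complex.I := by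
        push_cast
        ring
      rw [this, Complex.norm_exp_ofReal_mul_I]
  rw [h]
  refine (Complex.re_le_norm _).trans ?_
  rw [norm_mul, Complex.norm_exp_ofReal_mul_I, one_mul]

theorem exists_fourierMode_le {ν : Measure ℝ} (hR : IsRajchman ν) {ε : ℝ} (hε : 0 < ε) :
    ∃ Q : ℝ, 0 < Q ∧ ∀ ξ : ℝ, Q ≤ |ξ| → ‖fourierMode ν ξ‖ ≤ ε := by
  have h := (Metric.tendsto_nhds.1 hR) ε hε
  rw [eventually_comap, eventually_atTop] at h
  obtain ⟨Q, hQ⟩ := h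
  refine ⟨max Q 1, by positivity, fun ξ hξ => ?_⟩
  have := hQ |ξ| ((le_max_left _ _).trans hξ) ξ rfl
  rw [dist_zero_right] at this
  exact this.le

theorem abs_exp_mul_sum_cos_le {ε : ℝ} (hε : 0 ≤ ε) (K : ℕ) (u : ℕ → ℝ) :
    |Real.exp (ε * ∑ k ∈ Finset.range K, Real.cos (u k))| ≤ Real.exp (ε * K) := by
  rw [Real.abs_exp, Real.exp_le_exp]
  refine mul_le_mul_of_nonneg_left ?_ hε
  calc ∑ k ∈ Finset.range K, Real.cos (u k) ≤ ∑ k ∈ Finset.range K, (1 : ℝ) :=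
        Finset.sum_le_sum fun k _ => Real.cos_le_one _
    _ = K := by simp

section Moment

variable {ν : Measure ℝ} [IsProbabilityMeasure ν] {c R M D ε : ℝ}

/-- Conditioning on finer and finer pieces of a self-similar measure, the lacunary cosine sums
behave like sums of independent variables of small mean. -/
theorem integral_exp_sum_cos_le (hc : 0 < c)
    (hdec : ∀ ρ : ℝ, 0 < ρ → ρ ≤ 1 → HasScaleDecomposition ν c ρ)
    (hR : ∀ᵐ x ∂ν, |x| ≤ R) (hε : 0 < ε) (hε1 : ε ≤ 1) (hM : 0 < M)
    (hF : ∀ ξ : ℝ, c * M ≤ |ξ| → ‖fourierMode ν ξ‖ ≤ ε)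
    (hD : 0 < D) (hcD : 1 ≤ c * D) (hRD : 2 * Real.pi * M * R ≤ ε * D) (α : ℝ) (K : ℕ) :
    ∀ σ τ : ℝ, c * M ≤ |σ| → |σ| ≤ M →
      ∫ x, Real.exp (ε * ∑ k ∈ Finset.range K,
        Real.cos (2 * Real.pi * (D ^ k * (σ * x + τ)) + α)) ∂ν ≤ Real.exp (4 * ε ^ 2 * K) := by
  induction K with
  | zero =>
    intro σ τ _ _
    simp
  | succ K ih =>
    intro σ τ hσ1 hσ2
    have hσ0 : 0 < |σ| := lt_of_lt_of_le (by positivity) hσ1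
    -- At this scale the second frequency `D * σ` returns to the window: `c * M ≤ |D * σ * s w| ≤
    -- M`. The scale is at most `1` because `c * M ≤ |σ|` and `1 ≤ c * D`.
    obtain ⟨ι, _, p, s, t, hp0, hp1, hs, hint⟩ := hdec (M / (D * |σ|)) (by positivity) (by
      rw [div_le_one (by positivity)]
      nlinarith)
    set φ : ℝ → ℝ := fun x => Real.cos (2 * Real.pi * (σ * x + τ) + α) with hφ
    set G : ℝ → ℝ := fun x => ε * ∑ k ∈ Finset.range K,
      Real.cos (2 * Real.pi * (D ^ k * (D * σ * x + D * τ)) + α) with hG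
    have hφc : Continuous φ := by fun_prop
    have hGc : Continuous G := by fun_prop
    have hφ1 : ∀ x, |φ x| ≤ 1 := fun x => Real.abs_cos_le_one _
    have hφb : ∀ x, |Real.exp (ε * φ x)| ≤ Real.exp ε := fun x => by
      rw [Real.abs_exp, Real.exp_le_exp]
      nlinarith [(abs_le.1 (hφ1 x)).2]
    have hGb : ∀ x, |Real.exp (G x)| ≤ Real.exp (ε * K) := fun x =>
      abs_exp_mul_sum_cos_le hε.le K _
    have hosc : ∀ w x, |x| ≤ R → |φ (s w * x + t w) - φ (t w)| ≤ ε := by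
      intro w x hx
      refine (Real.abs_cos_sub_cos_le _ _).trans ?_
      have h1 : 2 * Real.pi * (σ * (s w * x + t w) + τ) + α - (2 * Real.pi * (σ * t w + τ) + α)
          = 2 * Real.pi * (σ * s w) * x := by ring
      rw [h1, abs_mul, abs_mul, abs_of_pos Real.two_pi_pos, abs_mul]
      have h2 : |σ| * |s w| ≤ M / D := by
        calc |σ| * |s w| ≤ |σ| * (M / (D * |σ|)) := by gcongr; exact (hs w).2
          _ = M / D := by field_simp
      calc 2 * Real.pi * (|σ| * |s w|) * |x| ≤ 2 * Real.pi * (M / D) * R := by gcongr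
        _ = 2 * Real.pi * M * R / D := by ring
        _ ≤ ε := by rwa [div_le_iff₀ hD]
    -- Replacing `φ` by the constant `φ (t w)` costs a factor `exp (ε²)`, and so does the way back.
    -- In between, the induction hypothesis bounds the remaining `K` terms.
    have hpiece : ∀ w, ∫ x, Real.exp (ε * φ (s w * x + t w)) * Real.exp (G (s w * x + t w)) ∂ν
        ≤ Real.exp (2 * ε ^ 2 + 4 * ε ^ 2 * K) * ∫ x, Real.exp (ε * φ (s w * x + t w)) ∂ν := by
      intro w
      have hup : ∫ x, Real.exp (ε * φ (s w * x + t w)) * Real.exp (G (s w * x + t w)) ∂ν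
          ≤ Real.exp (ε * φ (t w) + ε ^ 2) * Real.exp (4 * ε ^ 2 * K) := by
        calc _ ≤ ∫ x, Real.exp (ε * φ (t w) + ε ^ 2) * Real.exp (G (s w * x + t w)) ∂ν := by
              refine integral_mono_ae ?_ ?_ ?_
              · refine Continuous.integrable_of_abs_le (by fun_prop)
                  (C := Real.exp ε * Real.exp (ε * K)) fun x => ?_
                rw [abs_mul]
                exact mul_le_mul (hφb _) (hGb _) (abs_nonneg _) (Real.exp_pos _).le
              · exact (Continuous.integrable_of_abs_le (by fun_prop)
                  (C := Real.exp (ε * K)) fun x => hGb _).const_mul _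
              · filter_upwards [hR] with x hx
                refine mul_le_mul_of_nonneg_right (Real.exp_le_exp.2 ?_) (Real.exp_pos _).le
                nlinarith [(abs_le.1 (hosc w x hx)).2]
          _ = Real.exp (ε * φ (t w) + ε ^ 2) * ∫ x, Real.exp (G (s w * x + t w)) ∂ν :=
              integral_const_mul _ _
          _ ≤ _ := by
              refine mul_le_mul_of_nonneg_left ?_ (Real.exp_pos _).le
              have habs : |D * σ * s w| = D * |σ| * |s w| := by
                rw [abs_mul, abs_mul, abs_of_pos hD]
              have := ih (D * σ * s w) (D * σ * t w + D * τ) (by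
                rw [habs]
                calc c * M = D * |σ| * (c * (M / (D * |σ|))) := by field_simp
                  _ ≤ _ := by gcongr; exact (hs w).1) (by
                rw [habs]
                calc D * |σ| * |s w| ≤ D * |σ| * (M / (D * |σ|)) := by gcongr; exact (hs w).2
                  _ = M := by field_simp)
              refine le_of_eq_of_le ?_ this
              congr 1
              ext x
              simp only [hG]
              congr 3
              ext k
              ring_nf
      have hlow : Real.exp (ε * φ (t w))
          ≤ Real.exp (ε ^ 2) * ∫ x, Real.exp (ε * φ (s w * x + t w)) ∂ν := by
        rw [← integral_const_mul]
        calc Real.exp (ε * φ (t w)) = ∫ _, Real.exp (ε * φ (t w)) ∂ν := by simp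
          _ ≤ _ := by
            refine integral_mono_ae (integrable_const _) ?_ ?_
            · exact (Continuous.integrable_of_abs_le (by fun_prop)
                (C := Real.exp ε) fun x => hφb _).const_mul _
            · filter_upwards [hR] with x hx
              rw [← Real.exp_add, Real.exp_le_exp]
              nlinarith [(abs_le.1 (hosc w x hx)).1]
      calc _ ≤ _ := hup
        _ = Real.exp (ε ^ 2 + 4 * ε ^ 2 * K) * Real.exp (ε * φ (t w)) := by
            rw [← Real.exp_add, ← Real.exp_add]
            ring_nf
        _ ≤ Real.exp (ε ^ 2 + 4 * ε ^ 2 * K) *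
            (Real.exp (ε ^ 2) * ∫ x, Real.exp (ε * φ (s w * x + t w)) ∂ν) := by gcongr
        _ = _ := by
            rw [← mul_assoc, ← Real.exp_add]
            ring_nf
    -- Second-order expansion: one `ε²` is the quadratic term, the other is `ε` times the mean of
    -- `φ`, which Fourier decay bounds by `ε`.
    have hone : ∫ x, Real.exp (ε * φ x) ∂ν ≤ Real.exp (2 * ε ^ 2) := by
      have hφi : Integrable φ ν := hφc.integrable_of_abs_le hφ1
      calc ∫ x, Real.exp (ε * φ x) ∂ν ≤ ∫ x, ((1 + ε ^ 2) + ε * φ x) ∂ν := by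
            refine integral_mono (Continuous.integrable_of_abs_le (by fun_prop) hφb)
              ((integrable_const _).add (hφi.const_mul _)) fun x => ?_
            have h1 : |ε * φ x| ≤ ε := by
              rw [abs_mul, abs_of_pos hε]
              exact mul_le_of_le_one_right hε.le (hφ1 x)
            have h2 := Real.exp_le_one_add_add_sq (h1.trans hε1)
            have h3 : (ε * φ x) ^ 2 ≤ ε ^ 2 := sq_le_sq' (by linarith [(abs_le.1 h1).1])
              (abs_le.1 h1).2
            simp only
            linarith
        _ = (1 + ε ^ 2) + ε * ∫ x, φ x ∂ν := by
            rw [integral_add (integrable_const _) (hφi.const_mul _), integral_const_mul]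
            simp
        _ ≤ (1 + ε ^ 2) + ε * ε := by
            gcongr
            exact (integral_cos_affine_le σ τ α).trans (hF σ hσ1)
        _ = 2 * ε ^ 2 + 1 := by ring
        _ ≤ _ := Real.add_one_le_exp _
    calc ∫ x, Real.exp (ε * ∑ k ∈ Finset.range (K + 1),
          Real.cos (2 * Real.pi * (D ^ k * (σ * x + τ)) + α)) ∂ν
        = ∫ x, Real.exp (ε * φ x) * Real.exp (G x) ∂ν := by
          congr 1
          ext x
          -- The term `k = 0` has the lowest frequency; in the others one factor `D` is absorbed
          -- into `σ` and `τ`.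
          rw [← Real.exp_add, Finset.sum_range_succ', hG, hφ]
          simp only
          rw [← mul_add, add_comm]
          congr 3
          · simp
          · refine Finset.sum_congr rfl fun k _ => ?_
            ring_nf
      _ = ∑ w, p w * ∫ x, Real.exp (ε * φ (s w * x + t w)) * Real.exp (G (s w * x + t w)) ∂ν := by
          refine hint (fun x => Real.exp (ε * φ x) * Real.exp (G x)) (by fun_prop)
            ⟨Real.exp ε * Real.exp (ε * K), fun x => ?_⟩
          rw [abs_mul]
          exact mul_le_mul (hφb _) (hGb _) (abs_nonneg _) (Real.exp_pos _).le
      _ ≤ ∑ w, p w * (Real.exp (2 * ε ^ 2 + 4 * ε ^ 2 * K) *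
            ∫ x, Real.exp (ε * φ (s w * x + t w)) ∂ν) :=
          Finset.sum_le_sum fun w _ => mul_le_mul_of_nonneg_left (hpiece w) (hp0 w)
      _ = Real.exp (2 * ε ^ 2 + 4 * ε ^ 2 * K) * ∫ x, Real.exp (ε * φ x) ∂ν := by
          rw [hint (fun x => Real.exp (ε * φ x)) (by fun_prop) ⟨_, hφb⟩, Finset.mul_sum]
          refine Finset.sum_congr rfl fun w _ => ?_
          ring
      _ ≤ Real.exp (2 * ε ^ 2 + 4 * ε ^ 2 * K) * Real.exp (2 * ε ^ 2) := by gcongr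
      _ = Real.exp (4 * ε ^ 2 * (K + 1 : ℕ)) := by
          rw [← Real.exp_add]
          push_cast
          ring_nf

/-- One decomposition at scale `M / |ξ|` brings any large frequency into the window. -/
theorem integral_exp_sum_cos_le_of_large (hc : 0 < c)
    (hdec : ∀ ρ : ℝ, 0 < ρ → ρ ≤ 1 → HasScaleDecomposition ν c ρ)
    (hR : ∀ᵐ x ∂ν, |x| ≤ R) (hε : 0 < ε) (hε1 : ε ≤ 1) (hM : 0 < M)
    (hF : ∀ ξ : ℝ, c * M ≤ |ξ| → ‖fourierMode ν ξ‖ ≤ ε)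
    (hD : 0 < D) (hcD : 1 ≤ c * D) (hRD : 2 * Real.pi * M * R ≤ ε * D) (α : ℝ) (K : ℕ)
    {ξ : ℝ} (hξ : M ≤ |ξ|) :
    ∫ x, Real.exp (ε * ∑ k ∈ Finset.range K, Real.cos (2 * Real.pi * (D ^ k * (ξ * x)) + α)) ∂ν
      ≤ Real.exp (4 * ε ^ 2 * K) := by
  have hξ0 : 0 < |ξ| := hM.trans_le hξ
  obtain ⟨ι, _, p, s, t, hp0, hp1, hs, hint⟩ := hdec (M / |ξ|) (by positivity)
    ((div_le_one hξ0).2 hξ)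
  rw [hint (fun x => Real.exp (ε * ∑ k ∈ Finset.range K,
      Real.cos (2 * Real.pi * (D ^ k * (ξ * x)) + α))) (by fun_prop)
    ⟨Real.exp (ε * K), fun x => abs_exp_mul_sum_cos_le hε.le K _⟩]
  calc _ ≤ ∑ w, p w * Real.exp (4 * ε ^ 2 * K) := by
        refine Finset.sum_le_sum fun w _ => mul_le_mul_of_nonneg_left ?_ (hp0 w)
        have h := integral_exp_sum_cos_le hc hdec hR hε hε1 hM hF hD hcD hRD α K
          (ξ * s w) (ξ * t w) (by
            rw [abs_mul]
            calc c * M = |ξ| * (c * (M / |ξ|)) := by field_simp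
              _ ≤ _ := by gcongr; exact (hs w).1) (by
            rw [abs_mul]
            calc |ξ| * |s w| ≤ |ξ| * (M / |ξ|) := by gcongr; exact (hs w).2
              _ = M := by field_simp)
        refine le_of_eq_of_le ?_ h
        congr 1
        ext x
        congr 3
        ext k
        ring_nf
    _ = Real.exp (4 * ε ^ 2 * K) := by rw [← Finset.sum_mul, hp1, one_mul]

end Moment

/-! ### Almost sure bounds for cosine sums. -/

/-- Chernoff at parameter `ε` gives probability at most `exp (-5 ε² K + 4 ε² K) = exp (-ε² K)`,
which is summable, so Borel–Cantelli applies. -/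
theorem ae_eventually_le_of_integral_exp_le {ν : Measure ℝ} [IsProbabilityMeasure ν] {ε : ℝ}
    (hε : 0 < ε) {S : ℕ → ℝ → ℝ} (hi : ∀ K, Integrable (fun x => Real.exp (ε * S K x)) ν)
    (hS : ∀ K : ℕ, ∫ x, Real.exp (ε * S K x) ∂ν ≤ Real.exp (4 * ε ^ 2 * K)) :
    ∀ᵐ x ∂ν, ∀ᶠ K : ℕ in atTop, S K x ≤ 5 * ε * K := by
  have hbound : ∀ K : ℕ, ν {x | 5 * ε * K ≤ S K x} ≤ ENNReal.ofReal (Real.exp (-ε ^ 2) ^ K) := by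
    intro K
    rw [← ofReal_measureReal]
    refine ENNReal.ofReal_le_ofReal ?_
    refine (ProbabilityTheory.measure_ge_le_exp_mul_mgf (5 * ε * K) hε.le (hi K)).trans ?_
    calc _ ≤ Real.exp (-ε * (5 * ε * K)) * Real.exp (4 * ε ^ 2 * K) := by
          gcongr
          exact hS K
      _ = _ := by
          rw [← Real.exp_add, ← Real.exp_nat_mul]
          ring_nf
  have hsum : ∑' K : ℕ, ν {x | 5 * ε * K ≤ S K x} ≠ ⊤ := by
    have hlt : Real.exp (-ε ^ 2) < 1 := Real.exp_lt_one_iff.2 (by nlinarith)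
    refine ne_top_of_le_ne_top ?_ (ENNReal.tsum_le_tsum hbound)
    exact (summable_geometric_of_lt_one (Real.exp_pos _).le hlt).tsum_ofReal_ne_top
  filter_upwards [ae_eventually_notMem hsum] with x hx
  filter_upwards [hx] with K hK
  exact (not_le.1 hK).le

theorem sum_range_mul_eq_sum_residues (a : ℕ → ℝ) (L K : ℕ) :
    ∑ n ∈ Finset.range (L * K), a n
      = ∑ r ∈ Finset.range L, ∑ k ∈ Finset.range K, a (r + L * k) := by
  induction K with
  | zero => simp
  | succ K ih =>
    rw [Nat.mul_succ, Finset.sum_range_add, ih, ← Finset.sum_add_distrib]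
    refine Finset.sum_congr rfl fun r _ => ?_
    rw [Finset.sum_range_succ, add_comm r]

theorem sum_range_le_of_le_one {a : ℕ → ℝ} (ha : ∀ n, a n ≤ 1) (m : ℕ) :
    ∑ n ∈ Finset.range m, a n ≤ m := by
  calc ∑ n ∈ Finset.range m, a n ≤ ∑ n ∈ Finset.range m, (1 : ℝ) :=
        Finset.sum_le_sum fun n _ => ha n
    _ = m := by simp

/-- The `j` initial terms and the fewer than `L` final ones are each at most `1`, so `δ * N` absorbs
them. -/
theorem eventually_sum_range_le_of_residues {a : ℕ → ℝ} (ha : ∀ n, a n ≤ 1) {L : ℕ} (hL : 0 < L)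
    (j : ℕ) {C δ : ℝ} (hC : 0 ≤ C) (hδ : 0 < δ)
    (h : ∀ r < L, ∀ᶠ K : ℕ in atTop, ∑ k ∈ Finset.range K, a (j + (r + L * k)) ≤ C * K) :
    ∀ᶠ N : ℕ in atTop, ∑ n ∈ Finset.range N, a n ≤ (C + δ) * N := by
  have h1 : ∀ᶠ K : ℕ in atTop, ∀ r ∈ Finset.range L,
      ∑ k ∈ Finset.range K, a (j + (r + L * k)) ≤ C * K := by
    rw [eventually_all_finset]
    exact fun r hr => h r (Finset.mem_range.1 hr)
  have hK : Tendsto (fun N : ℕ => (N - j) / L) atTop atTop :=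
    (Nat.tendsto_div_const_atTop hL.ne').comp (tendsto_sub_atTop_nat j)
  filter_upwards [hK.eventually h1, eventually_ge_atTop j,
    tendsto_natCast_atTop_atTop.eventually_ge_atTop (((j : ℝ) + L) / δ)] with N hN hjN hbig
  set K := (N - j) / L
  set m := (N - j) % L
  have hdecomp : N = j + (L * K + m) := by
    have : L * K + m = N - j := Nat.div_add_mod (N - j) L
    omega
  have hm : (m : ℝ) ≤ L := by exact_mod_cast (Nat.mod_lt _ hL).le
  have hmain : ∑ n ∈ Finset.range (L * K), a (j + n) ≤ L * (C * K) := by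
    rw [sum_range_mul_eq_sum_residues fun n => a (j + n)]
    calc _ ≤ ∑ r ∈ Finset.range L, C * K := Finset.sum_le_sum hN
      _ = _ := by simp
  have hLK : (L : ℝ) * K ≤ N := by
    have : L * K ≤ N := by omega
    exact_mod_cast this
  have hsplit : ∑ n ∈ Finset.range N, a n ≤ j + (L * (C * K) + m) := by
    conv_lhs => rw [hdecomp]
    rw [Finset.sum_range_add, Finset.sum_range_add]
    exact add_le_add (sum_range_le_of_le_one ha j)
      (add_le_add hmain (sum_range_le_of_le_one (fun n => ha _) m))
  rw [div_le_iff₀ hδ] at hbig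
  nlinarith [mul_le_mul_of_nonneg_left hLK hC]

theorem ae_eventually_sum_cos_le {ν : Measure ℝ} (hν : IsSelfSimilarMeasure ν)
    (hR : IsRajchman ν) {b : ℕ} (hb : 2 ≤ b) {q : ℝ} (hq : q ≠ 0) (α : ℝ) {ε : ℝ} (hε : 0 < ε)
    (hε1 : ε ≤ 1) :
    ∀ᵐ x ∂ν, ∀ᶠ N : ℕ in atTop,
      ∑ n ∈ Finset.range N, Real.cos (2 * Real.pi * (q * b ^ n * x) + α) ≤ 6 * ε * N := by
  obtain ⟨hprob, m, Φ, p, hp, hp1, hself⟩ := hν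
  obtain ⟨c, hc, hdec⟩ := exists_hasScaleDecomposition hp hp1 hself
  obtain ⟨R, hsupp⟩ := exists_ae_abs_le_of_selfSimilar hp hp1 hself
  obtain ⟨Q, hQ, hF⟩ := exists_fourierMode_le hR hε
  set M := Q / c with hM
  have hM0 : 0 < M := by positivity
  have hcM : c * M = Q := by rw [hM]; field_simp
  have hb1 : (1 : ℝ) < b := by exact_mod_cast hb
  have hb0 : (0 : ℝ) < b := by linarith
  -- `ε` determines `M`, and only then is the gap `D = b ^ L` chosen. The entry `1` in the maximum
  -- forces `L > 0`. The shift `j` below makes the starting frequency `|q| * b ^ j` exceed `M`.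
  obtain ⟨L, hL⟩ := pow_unbounded_of_one_lt (max (max (1 / c) (2 * Real.pi * M * R / ε)) 1) hb1
  obtain ⟨j, hj⟩ := pow_unbounded_of_one_lt (M / |q|) hb1
  have hL0 : 0 < L := by
    rcases Nat.eq_zero_or_pos L with rfl | h
    · simp at hL
    · exact h
  have hcD : 1 ≤ c * (b : ℝ) ^ L := by
    have : 1 / c ≤ (b : ℝ) ^ L := ((le_max_left _ _).trans (le_max_left _ _)).trans hL.le
    rwa [div_le_iff₀ hc, mul_comm] at this
  have hRD : 2 * Real.pi * M * R ≤ ε * (b : ℝ) ^ L := by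
    have : 2 * Real.pi * M * R / ε ≤ (b : ℝ) ^ L :=
      ((le_max_right _ _).trans (le_max_left _ _)).trans hL.le
    rwa [div_le_iff₀ hε, mul_comm _ ε] at this
  have hres : ∀ᵐ x ∂ν, ∀ r : ℕ, ∀ᶠ K : ℕ in atTop, ∑ k ∈ Finset.range K,
      Real.cos (2 * Real.pi * (((b : ℝ) ^ L) ^ k * (q * b ^ (j + r) * x)) + α) ≤ 5 * ε * K := by
    rw [ae_all_iff]
    intro r
    refine ae_eventually_le_of_integral_exp_le hε (fun K => ?_) fun K => ?_
    · exact Continuous.integrable_of_abs_le (by fun_prop)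
        fun x => abs_exp_mul_sum_cos_le hε.le K _
    · refine integral_exp_sum_cos_le_of_large hc hdec hsupp hε hε1 hM0 (by rwa [hcM])
        (by positivity) hcD hRD α K ?_
      rw [div_lt_iff₀ (abs_pos.2 hq)] at hj
      rw [abs_mul, abs_of_pos (by positivity : (0 : ℝ) < b ^ (j + r)), mul_comm]
      refine hj.le.trans (mul_le_mul_of_nonneg_right ?_ (abs_nonneg _))
      exact pow_le_pow_right₀ hb1.le (Nat.le_add_right _ _)
  filter_upwards [hres] with x hx
  have := eventually_sum_range_le_of_residues
    (a := fun n => Real.cos (2 * Real.pi * (q * b ^ n * x) + α)) (fun n => Real.cos_le_one _)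
    hL0 j (C := 5 * ε) (by positivity) hε (fun r _ => by
      filter_upwards [hx r] with K hK
      refine le_of_eq_of_le (Finset.sum_congr rfl fun k _ => ?_) hK
      rw [← pow_mul, ← add_assoc, pow_add _ (j + r)]
      ring_nf)
  filter_upwards [this] with N hN
  linarith

/-! ### Orbits of the times-`b` map and Weyl's criterion on `[0, 1]`. -/

/-- The case `n = 0` is excluded because `x` itself is not reduced modulo `1`. -/
theorem timesMap_iterate (b : ℕ) (x : ℝ) {n : ℕ} (hn : 1 ≤ n) :
    (timesMap b)^[n] x = Int.fract ((b : ℝ) ^ n * x) := by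
  induction n, hn using Nat.le_induction with
  | base => simp [timesMap]
  | succ n _ ih =>
    rw [Function.iterate_succ_apply', ih, timesMap, Int.fract_eq_fract]
    refine ⟨-(b * ⌊(b : ℝ) ^ n * x⌋), ?_⟩
    rw [Int.fract]
    push_cast
    ring

theorem norm_average_le (f : ℕ → ℂ) {C : ℝ} (hC : 0 ≤ C) (hf : ∀ n, ‖f n‖ ≤ C) (N : ℕ) :
    ‖(1 / (N : ℂ)) * ∑ n ∈ Finset.Icc 1 N, f n‖ ≤ C := by
  have h1 : ‖∑ n ∈ Finset.Icc 1 N, f n‖ ≤ N * C := by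
    refine (norm_sum_le_of_le _ fun n _ => hf n).trans ?_
    simp
  rcases Nat.eq_zero_or_pos N with rfl | hN
  · simpa using hC
  · have hN' : (0 : ℝ) < N := by exact_mod_cast hN
    rw [norm_mul, norm_div, norm_one, Complex.norm_natCast, one_div_mul_eq_div, div_le_iff₀ hN']
    linarith

theorem intervalIntegral_fourier (q : ℤ) :
    ∫ t in (0 : ℝ)..1, fourier (T := 1) q (t : UnitAddCircle) = if q = 0 then 1 else 0 := by
  have h1 := fourierCoeff_eq_intervalIntegral (T := 1) (fourier q) 0 0
  rw [fourierCoeff_fourier] at h1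
  simp only [neg_zero, fourier_zero, one_smul, zero_add, div_one] at h1
  rw [← h1, Pi.single_apply]
  simp only [eq_comm]

/-- Weyl's criterion for continuous functions on the circle. -/
theorem tendsto_average_of_tendsto_average_fourier {y : ℕ → UnitAddCircle}
    (hy : ∀ q : ℤ, q ≠ 0 → Tendsto (fun N : ℕ => (1 / (N : ℂ)) *
      ∑ n ∈ Finset.Icc 1 N, fourier (T := 1) q (y n)) atTop (𝓝 0))
    (f : C(UnitAddCircle, ℂ)) :
    Tendsto (fun N : ℕ => (1 / (N : ℂ)) * ∑ n ∈ Finset.Icc 1 N, f (y n)) atTop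
      (𝓝 (∫ t in (0 : ℝ)..1, f (t : UnitAddCircle))) := by
  have hint : ∀ f : C(UnitAddCircle, ℂ),
      IntervalIntegrable (fun t : ℝ => f (t : UnitAddCircle)) volume 0 1 := fun f =>
    (f.continuous.comp (AddCircle.continuous_mk' 1)).intervalIntegrable 0 1
  -- Trigonometric polynomials follow by linearity; their uniform density then handles a general
  -- `f`.
  have hspan : ∀ g ∈ Submodule.span ℂ (Set.range (fourier (T := 1))),
      Tendsto (fun N : ℕ => (1 / (N : ℂ)) * ∑ n ∈ Finset.Icc 1 N, g (y n)) atTop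
        (𝓝 (∫ t in (0 : ℝ)..1, g (t : UnitAddCircle))) := by
    intro g hg
    induction hg using Submodule.span_induction with
    | mem g hg =>
      obtain ⟨q, rfl⟩ := hg
      rw [intervalIntegral_fourier]
      split_ifs with hq
      · subst hq
        refine tendsto_const_nhds.congr' ?_
        filter_upwards [eventually_ge_atTop 1] with N hN
        have : (N : ℂ) ≠ 0 := by exact_mod_cast (by omega : N ≠ 0)
        simp [this]
      · exact hy q hq
    | zero => simp
    | add g₁ g₂ _ _ h₁ h₂ =>
      simp only [ContinuousMap.add_apply, Finset.sum_add_distrib, mul_add]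
      rw [intervalIntegral.integral_add (hint g₁) (hint g₂)]
      exact h₁.add h₂
    | smul a g _ h =>
      simp only [ContinuousMap.smul_apply, ← Finset.smul_sum, mul_smul_comm]
      rw [intervalIntegral.integral_smul]
      exact h.const_smul a
  rw [Metric.tendsto_nhds]
  intro ε hε
  have hf : f ∈ closure (Submodule.span ℂ (Set.range (fourier (T := 1))) :
      Set C(UnitAddCircle, ℂ)) := by
    rw [← Submodule.topologicalClosure_coe, span_fourier_closure_eq_top]
    trivial
  obtain ⟨g, hg, hfg⟩ := Metric.mem_closure_iff.1 hf (ε / 3) (by positivity)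
  have hpt : ∀ t, ‖f t - g t‖ ≤ ε / 3 := fun t => by
    rw [← dist_eq_norm]
    exact (ContinuousMap.dist_apply_le_dist t).trans hfg.le
  filter_upwards [(Metric.tendsto_nhds.1 (hspan g hg)) (ε / 3) (by positivity)] with N hN
  have h1 : dist ((1 / (N : ℂ)) * ∑ n ∈ Finset.Icc 1 N, f (y n))
      ((1 / (N : ℂ)) * ∑ n ∈ Finset.Icc 1 N, g (y n)) ≤ ε / 3 := by
    rw [dist_eq_norm, ← mul_sub, ← Finset.sum_sub_distrib]
    exact norm_average_le (fun n => f (y n) - g (y n)) (by positivity) (fun n => hpt _) N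
  have h2 : dist (∫ t in (0 : ℝ)..1, g (t : UnitAddCircle))
      (∫ t in (0 : ℝ)..1, f (t : UnitAddCircle)) ≤ ε / 3 := by
    rw [dist_comm, dist_eq_norm, ← intervalIntegral.integral_sub (hint f) (hint g)]
    refine (intervalIntegral.norm_integral_le_of_norm_le_const fun t _ => hpt t).trans ?_
    simp
  have := dist_triangle4 ((1 / (N : ℂ)) * ∑ n ∈ Finset.Icc 1 N, f (y n))
    ((1 / (N : ℂ)) * ∑ n ∈ Finset.Icc 1 N, g (y n)) (∫ t in (0 : ℝ)..1, g (t : UnitAddCircle))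
    (∫ t in (0 : ℝ)..1, f (t : UnitAddCircle))
  linarith

section Interval

variable {z : ℕ → ℝ}

/-- Equal endpoint values let `g` descend to a continuous function on the circle. -/
theorem tendsto_average_of_eq_endpoints (hz : ∀ n, 1 ≤ n → z n ∈ Set.Ico (0 : ℝ) 1)
    (hy : ∀ q : ℤ, q ≠ 0 → Tendsto (fun N : ℕ => (1 / (N : ℂ)) *
      ∑ n ∈ Finset.Icc 1 N, fourier (T := 1) q (z n : UnitAddCircle)) atTop (𝓝 0))
    {g : ℝ → ℝ} (hg : ContinuousOn g (Set.Icc 0 1)) (hg01 : g 0 = g 1) :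
    Tendsto (fun N : ℕ => (1 / (N : ℝ)) * ∑ n ∈ Finset.Icc 1 N, g (z n)) atTop
      (𝓝 (∫ t in Set.Icc (0 : ℝ) 1, g t)) := by
  have hcont : Continuous (AddCircle.liftIco 1 0 g) :=
    AddCircle.liftIco_continuous (by simpa using hg01) (by simpa using hg)
  have hval : ∀ t ∈ Set.Ico (0 : ℝ) 1, AddCircle.liftIco 1 0 g (t : UnitAddCircle) = g t :=
    fun t ht => AddCircle.liftIco_coe_apply (by simpa using ht)
  have h := tendsto_average_of_tendsto_average_fourier hy
    ⟨fun t => ((AddCircle.liftIco 1 0 g t : ℝ) : ℂ), Complex.continuous_ofReal.comp hcont⟩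
  simp only [ContinuousMap.coe_mk] at h
  rw [intervalIntegral.integral_ofReal] at h
  have h' := (Complex.continuous_re.tendsto _).comp h
  rw [Complex.ofReal_re] at h'
  convert h' using 1
  · ext N
    have : (1 / (N : ℂ)) * ∑ n ∈ Finset.Icc 1 N,
        ((AddCircle.liftIco 1 0 g (z n : UnitAddCircle) : ℝ) : ℂ)
        = ((1 / (N : ℝ) * ∑ n ∈ Finset.Icc 1 N, g (z n) : ℝ) : ℂ) := by
      push_cast
      congr 1
      refine Finset.sum_congr rfl fun n hn => ?_
      rw [hval _ (hz n (Finset.mem_Icc.1 hn).1)]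
    rw [Function.comp_apply, this, Complex.ofReal_re]
  · congr 1
    rw [integral_Icc_eq_integral_Ioc, ← intervalIntegral.integral_of_le zero_le_one]
    refine intervalIntegral.integral_congr fun t ht => ?_
    rw [Set.uIcc_of_le zero_le_one] at ht
    rcases ht.2.lt_or_eq with hlt | rfl
    · exact (hval t ⟨ht.1, hlt⟩).symm
    · have h10 : ((1 : ℝ) : UnitAddCircle) = ((0 : ℝ) : UnitAddCircle) := by
        simp
      rw [h10, hval 0 (by simp), hg01]

/-- This function equals `1` at both endpoints and has small integral, so it serves to correct
unequal endpoint values. -/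
theorem setIntegral_peak (m : ℕ) :
    ∫ t in Set.Icc (0 : ℝ) 1, (2 * t - 1) ^ (2 * m) = 1 / (2 * m + 1) := by
  rw [integral_Icc_eq_integral_Ioc, ← intervalIntegral.integral_of_le zero_le_one,
    intervalIntegral.integral_comp_mul_sub (fun t : ℝ => t ^ (2 * m)) two_ne_zero, integral_pow]
  have : (-1 : ℝ) ^ (2 * m + 1) = -1 := Odd.neg_one_pow ⟨m, rfl⟩
  norm_num [this]
  field_simp

/-- Weyl's criterion for continuous functions on `[0, 1]` with possibly different values at the
endpoints. -/
theorem tendsto_average_of_continuousOn (hz : ∀ n, 1 ≤ n → z n ∈ Set.Ico (0 : ℝ) 1)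
    (hy : ∀ q : ℤ, q ≠ 0 → Tendsto (fun N : ℕ => (1 / (N : ℂ)) *
      ∑ n ∈ Finset.Icc 1 N, fourier (T := 1) q (z n : UnitAddCircle)) atTop (𝓝 0))
    {g : ℝ → ℝ} (hg : ContinuousOn g (Set.Icc 0 1)) :
    Tendsto (fun N : ℕ => (1 / (N : ℝ)) * ∑ n ∈ Finset.Icc 1 N, g (z n)) atTop
      (𝓝 (∫ t in Set.Icc (0 : ℝ) 1, g t)) := by
  obtain ⟨C₀, hC₀⟩ := isCompact_Icc.exists_bound_of_continuousOn hg
  set C := max C₀ 1 with hCdef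
  have hC : ∀ t ∈ Set.Icc (0 : ℝ) 1, |g t| ≤ C := fun t ht => (hC₀ t ht).trans (le_max_left _ _)
  have hC0 : 0 < C := lt_of_lt_of_le one_pos (le_max_right _ _)
  rw [Metric.tendsto_nhds]
  intro ε hε
  obtain ⟨m, hm⟩ := exists_nat_gt (4 * C / ε)
  -- `g * (1 - h)` vanishes at both endpoints, so the circle case applies to it. The error is at
  -- most `C * h`, and the averages of `h` converge to its integral `1 / (2 * m + 1)`.
  set h : ℝ → ℝ := fun t => (2 * t - 1) ^ (2 * m) with hh
  have hh0 : ∀ t, 0 ≤ h t := fun t => by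
    simp only [hh, pow_mul]
    positivity
  have hhc : Continuous h := by fun_prop
  have hhI : ∫ t in Set.Icc (0 : ℝ) 1, h t = 1 / (2 * m + 1) := setIntegral_peak m
  have hmε : C * (1 / (2 * m + 1)) < ε / 4 := by
    rw [div_lt_iff₀ hε] at hm
    rw [mul_one_div, div_lt_iff₀ (by positivity)]
    nlinarith
  have hend0 : h 0 = 1 := by simp [hh]
  have hend1 : h 1 = 1 := by norm_num [hh]
  have hgt : ContinuousOn (fun t => g t * (1 - h t)) (Set.Icc 0 1) :=
    hg.mul (by fun_prop)
  have t1 := tendsto_average_of_eq_endpoints hz hy hgt (by simp [hend0, hend1])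
  have t2 := (tendsto_average_of_eq_endpoints hz hy hhc.continuousOn
    (by rw [hend0, hend1])).const_mul C
  rw [hhI] at t2
  have hIdiff : |(∫ t in Set.Icc (0 : ℝ) 1, g t * (1 - h t)) - ∫ t in Set.Icc (0 : ℝ) 1, g t|
      < ε / 4 := by
    refine lt_of_le_of_lt ?_ hmε
    rw [← integral_sub hgt.integrableOn_Icc hg.integrableOn_Icc, ← hhI, ← integral_const_mul,
      ← Real.norm_eq_abs]
    refine norm_integral_le_of_norm_le (hhc.continuousOn.integrableOn_Icc.const_mul C) ?_
    filter_upwards [ae_restrict_mem measurableSet_Icc] with t ht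
    rw [show g t * (1 - h t) - g t = -(g t * h t) by ring, norm_neg, norm_mul,
      Real.norm_of_nonneg (hh0 t)]
    exact mul_le_mul_of_nonneg_right (hC t ht) (hh0 t)
  filter_upwards [(Metric.tendsto_nhds.1 t1) (ε / 4) (by positivity),
    t2.eventually_lt_const hmε] with N h1 h2
  have hAdiff : |(1 / (N : ℝ)) * ∑ n ∈ Finset.Icc 1 N, g (z n)
      - (1 / (N : ℝ)) * ∑ n ∈ Finset.Icc 1 N, g (z n) * (1 - h (z n))|
      ≤ C * ((1 / (N : ℝ)) * ∑ n ∈ Finset.Icc 1 N, h (z n)) := by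
    rw [← mul_sub, ← Finset.sum_sub_distrib, abs_mul, abs_of_nonneg (by positivity),
      mul_left_comm C]
    refine mul_le_mul_of_nonneg_left ?_ (by positivity)
    rw [Finset.mul_sum]
    refine (Finset.abs_sum_le_sum_abs _ _).trans (Finset.sum_le_sum fun n hn => ?_)
    rw [show g (z n) - g (z n) * (1 - h (z n)) = g (z n) * h (z n) by ring, abs_mul,
      abs_of_nonneg (hh0 _)]
    exact mul_le_mul_of_nonneg_right
      (hC _ (Set.Ico_subset_Icc_self (hz n (Finset.mem_Icc.1 hn).1))) (hh0 _)
  rw [Real.dist_eq] at h1 ⊢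
  rw [abs_lt] at h1 hIdiff ⊢
  rw [abs_le] at hAdiff
  constructor <;> linarith [h1.1, h1.2, hIdiff.1, hIdiff.2, hAdiff.1, hAdiff.2]

end Interval

/-! ### From cosine sums to normality. -/

theorem isNormalToBase_of_tendsto_average_fourier {b : ℕ} {x : ℝ}
    (h : ∀ q : ℤ, q ≠ 0 → Tendsto (fun N : ℕ => (1 / (N : ℂ)) *
      ∑ n ∈ Finset.Icc 1 N, fourier (T := 1) q (((b : ℝ) ^ n * x : ℝ) : UnitAddCircle))
      atTop (𝓝 0)) :
    IsNormalToBase b x := by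
  intro g hg
  refine tendsto_average_of_continuousOn (fun n hn => ?_) (fun q hq => ?_) hg
  · rw [timesMap_iterate b x hn]
    exact ⟨Int.fract_nonneg _, Int.fract_lt_one _⟩
  · refine (h q hq).congr fun N => ?_
    congr 1
    refine Finset.sum_congr rfl fun n hn => ?_
    rw [timesMap_iterate b x (Finset.mem_Icc.1 hn).1]
    congr 1
    rw [← sub_eq_zero, ← AddCircle.coe_sub, AddCircle.coe_eq_zero_iff]
    refine ⟨⌊(b : ℝ) ^ n * x⌋, ?_⟩
    rw [Int.fract]
    simp

/-- The four phases turn the cosine into `cos`, `-cos`, `-sin` and `sin`, so one-sided bounds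
control the absolute values of the real and imaginary parts. -/
theorem tendsto_average_fourier_of_cos {y : ℕ → ℝ} (q : ℤ)
    (h : ∀ α ∈ ({0, Real.pi, Real.pi / 2, -(Real.pi / 2)} : Set ℝ), ∀ k : ℕ, ∀ᶠ N : ℕ in atTop,
      ∑ n ∈ Finset.Icc 1 N, Real.cos (2 * Real.pi * (q * y n) + α) ≤ 6 * (1 / (k + 1)) * N) :
    Tendsto (fun N : ℕ => (1 / (N : ℂ)) *
      ∑ n ∈ Finset.Icc 1 N, fourier (T := 1) q (y n : UnitAddCircle)) atTop (𝓝 0) := by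
  rw [Metric.tendsto_nhds]
  intro ε hε
  -- Real and imaginary parts contribute `6 / (k + 1)` each, hence `ε / 12`.
  obtain ⟨k, hk⟩ := exists_nat_one_div_lt (show 0 < ε / 12 by positivity)
  filter_upwards [h 0 (by simp) k, h Real.pi (by simp) k, h (Real.pi / 2) (by simp) k,
    h (-(Real.pi / 2)) (by simp) k, eventually_ge_atTop 1] with N h1 h2 h3 h4 hN
  have hN' : (0 : ℝ) < N := by exact_mod_cast hN
  simp only [add_zero, Real.cos_add_pi, Real.cos_add_pi_div_two, ← sub_eq_add_neg,
    Real.cos_sub_pi_div_two, Finset.sum_neg_distrib] at h1 h2 h3 h4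
  have hexp : ∀ n, fourier (T := 1) q (y n : UnitAddCircle)
      = Complex.exp ((2 * Real.pi * (q * y n) : ℝ) * Complex.I) := fun n => by
    rw [fourier_coe_apply]
    congr 1
    push_cast
    ring
  have hre : (∑ n ∈ Finset.Icc 1 N, fourier (T := 1) q (y n : UnitAddCircle)).re
      = ∑ n ∈ Finset.Icc 1 N, Real.cos (2 * Real.pi * (q * y n)) := by
    rw [Complex.re_sum]
    exact Finset.sum_congr rfl fun n _ => by rw [hexp, Complex.exp_ofReal_mul_I_re]
  have him : (∑ n ∈ Finset.Icc 1 N, fourier (T := 1) q (y n : UnitAddCircle)).im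
      = ∑ n ∈ Finset.Icc 1 N, Real.sin (2 * Real.pi * (q * y n)) := by
    rw [Complex.im_sum]
    exact Finset.sum_congr rfl fun n _ => by rw [hexp, Complex.exp_ofReal_mul_I_im]
  rw [dist_zero_right, norm_mul, norm_div, norm_one, Complex.norm_natCast, one_div_mul_eq_div,
    div_lt_iff₀ hN']
  refine (Complex.norm_le_abs_re_add_abs_im _).trans_lt ?_
  rw [hre, him]
  have hc := abs_le.2 ⟨neg_le.1 h2, h1⟩
  have hs := abs_le.2 ⟨neg_le.1 h3, h4⟩
  have := mul_lt_mul_of_pos_right hk hN'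
  linarith

theorem theorem1p2 (ν : Measure ℝ) (hν : IsSelfSimilarMeasure ν) (hna : ∀ x : ℝ, ν {x} = 0)
    (hR : IsRajchman ν) : IsPointwiseAbsolutelyNormal ν := by
  -- Only countably many `b`, `q`, `k` and four phases occur, so a single null set suffices. The
  -- extra factor `b` in the frequency turns the sum over `range N` into one over exponents `1` to
  -- `N`.
  have key : ∀ᵐ x ∂ν, ∀ b : ℕ, ∀ q : ℤ, ∀ k : ℕ,
      ∀ α ∈ ({0, Real.pi, Real.pi / 2, -(Real.pi / 2)} : Set ℝ), 2 ≤ b → q ≠ 0 →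
        ∀ᶠ N : ℕ in atTop, ∑ n ∈ Finset.range N,
          Real.cos (2 * Real.pi * (q * b * b ^ n * x) + α) ≤ 6 * (1 / (k + 1)) * N := by
    simp only [ae_all_iff]
    intro b q k
    rw [ae_ball_iff (Set.toFinite _).countable]
    intro α _
    simp only [eventually_imp_distrib_left]
    intro hb hq
    have hb0 : (b : ℝ) ≠ 0 := by exact_mod_cast (by omega : b ≠ 0)
    refine ae_eventually_sum_cos_le hν hR hb (mul_ne_zero (by exact_mod_cast hq) hb0) α
      (by positivity) ?_
    rw [div_le_one (by positivity)]
    linarith [(Nat.cast_nonneg k : (0 : ℝ) ≤ k)]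
  filter_upwards [key] with x hx b hb
  refine isNormalToBase_of_tendsto_average_fourier fun q hq => ?_
  refine tendsto_average_fourier_of_cos (y := fun n => (b : ℝ) ^ n * x) q fun α hα k => ?_
  filter_upwards [hx b q k α hα hb hq] with N hN
  refine le_of_eq_of_le ?_ hN
  rw [← Finset.Ico_add_one_right_eq_Icc, Finset.sum_Ico_eq_sum_range]
  refine Finset.sum_congr (by simp) fun n _ => ?_
  rw [pow_add]
  ring_nf
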